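/- Let $k$ be an algebraically closed field, $G=GL_n(k)$, and let $\mathcal N_n$ be the set of nilpotent $n\times n$ matrices over $k$. Let $$C_r(\mathcal N_n)=\{(x_1,\dots,x_r)\in\mathcal N_n^r : x_ix_j=x_jx_i \text{ for all } i,j\},$$ and equip it and all sets of $r$-tuples of $n\times n$ matrices below with the Zariski topology of the affine space $\mathfrak{gl}_n(k)^r\cong k^{rn^2}$; $\dim$ denotes Krull dimension. Let $N_n^r$ be the Zariski closure of the set of those $(x_1,\dots,x_r)\in C_r(\mathcal N_n)$ whose first matrix $x_1$ is regular, i.e. conjugate to the nilpotent Jordan block of size $n$. Let $P\subset G$ be the parabolic subgroup of lower block triangular matrices with diagonal blocks of sizes $\lceil n/2\rceil,\lfloor n/2\rfloor$, let $$\mathfrak u_P=\left\{\begin{pmatrix}0&0\\A&0\end{pmatrix} : A\in \mathrm{Mat}_{\lfloor n/2\rfloor\times\lceil n/2\rceil}(k)\right\}$$ be the Lie algebra of its unipotent radical, and let $V_P=G\cdot\mathfrak u_P^r$ be the set of all simultaneous conjugates $(gx_1g^{-1},\dots,gx_rg^{-1})$ with $g\in G$ and $x_1,\dots,x_r\in\mathfrak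 u_P$. **Theorem.** Suppose that either $n>3$ and $r\ge 6$, or $n>7$ and $r>3$. Then $$\dim V_P>\dim N_n^r=n^2-n+(r-1)(n-1).$$ Moreover, $C_r(\mathcal N_n)$ is not equidimensional: it has two irreducible components of different dimensions. -/

import Mathlib

namespace NilpotentCommuting

/-- The common zeros in the affine space `k^σ` of a set `S` of polynomials. -/
def zeroSet {σ k : Type*} [Field k] (S : Set (MvPolynomial σ k)) : Set (σ → k) :=
  {x | ∀ p ∈ S, MvPolynomial.eval x p = 0}

/-- The Zariski topology on the affine space `k^σ`: the closed sets are the sets of common zeros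
of sets of polynomials. -/
abbrev affineZariski (σ k : Type*) [Field k] : TopologicalSpace (σ → k) :=
  TopologicalSpace.ofClosed {Z | ∃ S : Set (MvPolynomial σ k), Z = zeroSet S}
    ⟨{1}, by ext x; simp [zeroSet]⟩
    (by
      intro A hA
      refine ⟨{p | ∃ S : Set (MvPolynomial σ k), zeroSet S ∈ A ∧ p ∈ S}, ?_⟩
      ext x
      constructor
      · rintro hx p ⟨S, hS, hp⟩
        exact hx _ hS p hp
      · intro hx Z hZ
        obtain ⟨S, rfl⟩ := hA hZ
        exact fun p hp => hx p ⟨S, hZ, hp⟩)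
    (by
      rintro _ ⟨S, rfl⟩ _ ⟨T, rfl⟩
      refine ⟨{f | ∃ p ∈ S, ∃ q ∈ T, f = p * q}, ?_⟩
      ext x
      constructor
      · rintro (hx | hx) _ ⟨p, hp, q, hq, rfl⟩
        · rw [map_mul, hx p hp, zero_mul]
        · rw [map_mul, hx q hq, mul_zero]
      · intro hx
        by_contra hc
        simp only [Set.mem_union, not_or, zeroSet, Set.mem_ofPred_eq, not_forall] at hc
        obtain ⟨⟨p, hp, hpx⟩, q, hq, hqx⟩ := hc
        have h := hx (p * q) ⟨p, hp, q, hq, rfl⟩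
        rw [map_mul] at h
        exact (mul_ne_zero hpx hqx) h)

/-- The space of `r`-tuples of `n × n` matrices over `k`, an affine space of dimension
`r * n ^ 2`, to be given its Zariski topology. -/
def MatTuple (n r : ℕ) (k : Type*) : Type _ := Fin r → Matrix (Fin n) (Fin n) k

/-- The `r * n ^ 2` coordinates of a tuple of matrices. -/
def MatTuple.coords {n r : ℕ} {k : Type*} (x : MatTuple n r k) : Fin r × Fin n × Fin n → k :=
  fun s => x s.1 s.2.1 s.2.2

/-- The Zariski topology on tuples of matrices (`MatTuple.coords` is a bijection). -/
instance MatTuple.instTopologicalSpace {n r : ℕ} {k : Type*} [Field k] : TopologicalSpace (MatTuple n r k) :=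
  (affineZariski (Fin r × Fin n × Fin n) k).induced MatTuple.coords

/-- A topological space is equidimensional if all its irreducible components have the same
Krull dimension. -/
def IsEquidimensional (X : Type*) [TopologicalSpace X] : Prop :=
  ∀ Z ∈ irreducibleComponents X, ∀ W ∈ irreducibleComponents X,
    topologicalKrullDim Z = topologicalKrullDim W

variable (n r : ℕ) (k : Type*) [Field k]

/-- The nilpotent cone: all nilpotent `n × n` matrices. -/
def nilpotentCone : Set (Matrix (Fin n) (Fin n) k) := {x | IsNilpotent x}

/-- The variety of `r`-tuples of pairwise commuting elements of a set `V` of matrices. -/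
def commutingVariety {n : ℕ} (r : ℕ) {k : Type*} [Field k] (V : Set (Matrix (Fin n) (Fin n) k)) :
    Set (MatTuple n r k) :=
  {x | (∀ i, x i ∈ V) ∧ ∀ i j, Commute (x i) (x j)}

/-- The simultaneous conjugation action of `GL_n(k)` on `r`-tuples of matrices. -/
def conj {n r : ℕ} {k : Type*} [Field k] (g : GL (Fin n) k) (x : MatTuple n r k) :
    MatTuple n r k :=
  fun i => (g : Matrix (Fin n) (Fin n) k) * x i * ((g⁻¹ : GL (Fin n) k) : Matrix (Fin n) (Fin n) k)

/-- The nilpotent Jordan block of size `n`. -/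
def xReg : Matrix (Fin n) (Fin n) k :=
  Matrix.of fun i j => if (i : ℕ) + 1 = (j : ℕ) then 1 else 0

/-- A nilpotent matrix is regular if it is conjugate to the nilpotent Jordan block of full size. -/
def IsRegularNilpotent {n : ℕ} {k : Type*} [Field k] (x : Matrix (Fin n) (Fin n) k) : Prop :=
  ∃ g : GL (Fin n) k,
    x = (g : Matrix (Fin n) (Fin n) k) * xReg n k *
      ((g⁻¹ : GL (Fin n) k) : Matrix (Fin n) (Fin n) k)

/-- The Zariski closure of the set of commuting `r`-tuples of nilpotent matrices whose first
matrix is regular. -/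
def regularClosure : Set (MatTuple n r k) :=
  closure {x | x ∈ commutingVariety r (nilpotentCone n k) ∧
    ∃ i : Fin r, (i : ℕ) = 0 ∧ IsRegularNilpotent (x i)}

/-- The Lie algebra of the unipotent radical of the (lower block triangular) parabolic subgroup
with diagonal blocks of sizes `⌈n / 2⌉`, `⌊n / 2⌋`: the matrices whose entries vanish outside the
lower left block, formed by the last `⌊n / 2⌋` rows and the first `⌈n / 2⌉ = (n + 1) / 2`
columns. -/
def nilradical : Submodule k (Matrix (Fin n) (Fin n) k) where
  carrier := {x | ∀ i j : Fin n, ¬ ((n + 1) / 2 ≤ (i : ℕ) ∧ (j : ℕ) < (n + 1) / 2) → x i j = 0}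
  add_mem' := by
    intro a b ha hb i j h
    rw [Matrix.add_apply, ha i j h, hb i j h, add_zero]
  zero_mem' := fun _ _ _ => rfl
  smul_mem' := by
    intro c a ha i j h
    rw [Matrix.smul_apply, ha i j h, smul_zero]

/-- The variety `V_P = G · 𝔲_P^r`: all simultaneous conjugates of `r`-tuples in `𝔲_P`. -/
def VP : Set (MatTuple n r k) :=
  {y | ∃ (g : GL (Fin n) k) (x : MatTuple n r k), (∀ i, x i ∈ nilradical n k) ∧ y = conj g x}

end NilpotentCommuting

/-! Both varieties are compared through explicit parametrizations by nonempty open subsets of affine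
spaces, with inverses given by quotients of polynomials.

If the first standard row vector `e₀` is cyclic for `x 0`, the matrix `H` with rows `e₀ (x 0)^a`
conjugates `x 0` to the Jordan block and the other entries to nilpotent matrices commuting with it,
that is, to polynomials in the block without constant term. Since `H` always has first row `e₀`, it
has `n(n-1)` free entries, and each remaining matrix has `n-1` free coefficients. These tuples form
`cyclicLocus`, which is dense in `regularClosure` (`regularClosure_eq`), whence the formula
`topologicalKrullDim_regularClosure`.

Conjugating `𝔲_P^r` by the opposite unipotent group gives a cell in `VP` with `(r+1)⌈n/2⌉⌊n/2⌋`
parameters, which bounds the dimension from below (`le_topologicalKrullDim_VP`). The strict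
inequality is then `card_cyclicParam_lt_card_cellParam`.

For the components, `cyclicLocus` is irreducible and open in the commuting variety, so a component
containing it has dimension at most that of `regularClosure`. The cell is irreducible too, and a
component containing it is strictly larger in dimension. -/

namespace NilpotentCommuting

open MvPolynomial Topology

attribute [local instance] affineZariski

/-! ### Regular functions, irreducibility and dimension in the Zariski topology. -/

section Zariski

variable {k : Type*} [Field k] {σ τ : Type*}

theorem isClosed_iff_exists_zeroSet {Z : Set (σ → k)} :
    IsClosed Z ↔ ∃ S : Set (MvPolynomial σ k), Z = zeroSet S := by
  rw [← isOpen_compl_iff]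
  change Zᶜᶜ ∈ {Z | ∃ S : Set (MvPolynomial σ k), Z = zeroSet S} ↔ _
  rw [compl_compl]; rfl

/-- The algebra of functions `P / Q` on a set `X` over an affine space, where `P` and `Q` are
polynomials and `Q` has no zero on `X`. -/
def regFun {X : Type*} (ι : X → σ → k) : Subalgebra k (X → k) where
  carrier := {u | ∃ P Q : MvPolynomial σ k, ∀ x, eval (ι x) Q ≠ 0 ∧
    u x * eval (ι x) Q = eval (ι x) P}
  mul_mem' := by
    rintro u v ⟨P, Q, h⟩ ⟨P', Q', h'⟩
    refine ⟨P * P', Q * Q', fun x => ?_⟩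
    simp only [map_mul, Pi.mul_apply, ← (h x).2, ← (h' x).2]
    exact ⟨mul_ne_zero (h x).1 (h' x).1, by ring⟩
  add_mem' := by
    rintro u v ⟨P, Q, h⟩ ⟨P', Q', h'⟩
    refine ⟨P * Q' + P' * Q, Q * Q', fun x => ?_⟩
    simp only [map_mul, map_add, Pi.add_apply, ← (h x).2, ← (h' x).2]
    exact ⟨mul_ne_zero (h x).1 (h' x).1, by ring⟩
  algebraMap_mem' c := ⟨C c, 1, fun x => by simp⟩

variable {X Y : Type*} {ι : X → σ → k} {ιY : Y → τ → k}

theorem coord_mem_regFun (ι : X → σ → k) (s : σ) : (fun x => ι x s) ∈ regFun ι :=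
  ⟨MvPolynomial.X s, 1, fun x => by simp⟩

theorem const_mem_regFun (ι : X → σ → k) (c : k) : (fun _ => c) ∈ regFun ι :=
  (regFun ι).algebraMap_mem c

theorem inv_mem_regFun {u : X → k} (hu : u ∈ regFun ι) (h0 : ∀ x, u x ≠ 0) :
    (fun x => (u x)⁻¹) ∈ regFun ι := by
  obtain ⟨P, Q, h⟩ := hu
  refine ⟨Q, P, fun x => ?_⟩
  rw [← (h x).2]
  refine ⟨mul_ne_zero (h0 x) (h x).1, ?_⟩
  rw [inv_mul_cancel_left₀ (h0 x)]

theorem eval_comp_mem_regFun {f : X → τ → k} (hf : ∀ t, (fun x => f x t) ∈ regFun ι)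
    (p : MvPolynomial τ k) : (fun x => eval (f x) p) ∈ regFun ι := by
  have h : (fun x => eval (f x) p) =
      ((aeval (fun t => (⟨fun x => f x t, hf t⟩ : regFun ι)) p : regFun ι) : X → k) := by
    ext x
    have : (((Pi.evalAlgHom k (fun _ : X => k) x).comp (regFun ι).val).comp
        (aeval fun t => (⟨fun x => f x t, hf t⟩ : regFun ι))) = aeval (f x) := by
      ext t; simp
    have := congrArg (fun φ => φ p) this
    simpa [aeval_eq_eval] using this.symm
  rw [h]
  exact Subtype.property _

theorem isClosed_zeros_of_mem_regFun [TopologicalSpace X] (hι : IsInducing ι) {u : X → k}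
    (hu : u ∈ regFun ι) : IsClosed {x | u x = 0} := by
  obtain ⟨P, Q, h⟩ := hu
  have : {x | u x = 0} = ι ⁻¹' zeroSet {P} := by
    ext x
    simp [zeroSet, ← (h x).2, (h x).1]
  rw [this]
  exact (isClosed_iff_exists_zeroSet.2 ⟨_, rfl⟩).preimage hι.continuous

/-- A polynomial in regular functions is regular, and the zeros of a regular function are those of
its numerator. So the preimage of a zero set is an intersection of closed sets. -/
theorem continuous_of_mem_regFun [TopologicalSpace X] [TopologicalSpace Y] (hι : IsInducing ι)
    (hιY : IsInducing ιY) {f : X → Y} (hf : ∀ t, (fun x => ιY (f x) t) ∈ regFun ι) :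
    Continuous f := by
  rw [hιY.continuous_iff, continuous_iff_isClosed]
  intro Z hZ
  obtain ⟨S, rfl⟩ := isClosed_iff_exists_zeroSet.1 hZ
  have : (ιY ∘ f) ⁻¹' zeroSet S = ⋂ p ∈ S, {x | eval (ιY (f x)) p = 0} := by
    ext x; simp [zeroSet]
  rw [this]
  exact isClosed_biInter fun p _ => isClosed_zeros_of_mem_regFun hι (eval_comp_mem_regFun hf p)

theorem isInducing_restrict [TopologicalSpace X] (hι : IsInducing ι) (S : Set X) :
    IsInducing fun x : S => ι x :=
  hι.comp IsInducing.subtypeVal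

theorem isInducing_id_affine : IsInducing (fun x : σ → k => x) := IsInducing.id

instance affine_irreducibleSpace [Infinite k] : IrreducibleSpace (σ → k) where
  toPreirreducibleSpace := by
    refine PreirreducibleSpace.of_forall_nonempty_inter ?_
    intro U V hU hV ⟨x, hx⟩ ⟨y, hy⟩
    obtain ⟨S, hS⟩ := isClosed_iff_exists_zeroSet.1 hU.isClosed_compl
    obtain ⟨T, hT⟩ := isClosed_iff_exists_zeroSet.1 hV.isClosed_compl
    have hx' : x ∉ zeroSet S := by rw [← hS]; simpa using hx
    have hy' : y ∉ zeroSet T := by rw [← hT]; simpa using hy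
    simp only [zeroSet, Set.mem_ofPred_eq, not_forall] at hx' hy'
    obtain ⟨p, hp, hpx⟩ := hx'
    obtain ⟨q, hq, hqy⟩ := hy'
    have hpq : p * q ≠ 0 := by
      refine mul_ne_zero ?_ ?_
      · rintro rfl; simp at hpx
      · rintro rfl; simp at hqy
    have : ∃ z, eval z (p * q) ≠ 0 := by
      by_contra! h
      exact hpq (MvPolynomial.funext fun z => by simpa using h z)
    obtain ⟨z, hz⟩ := this
    rw [map_mul] at hz
    refine ⟨z, ?_, ?_⟩
    · by_contra hzU
      have : z ∈ zeroSet S := by rw [← hS]; exact hzU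
      exact left_ne_zero_of_mul hz (this p hp)
    · by_contra hzV
      have : z ∈ zeroSet T := by rw [← hT]; exact hzV
      exact right_ne_zero_of_mul hz (this q hq)
  toNonempty := ⟨fun _ => 0⟩

/-- A full flag of coordinate subspaces through a point `t` of `U` stays a strict chain of
irreducible closed sets after intersection with `U`. -/
theorem card_le_topologicalKrullDim_of_isOpen [Infinite k] [Fintype τ] {U : Set (τ → k)}
    (hU : IsOpen U) (hne : U.Nonempty) :
    ((Fintype.card τ : ℕ) : WithBot ℕ∞) ≤ topologicalKrullDim U := by
  classical
  obtain ⟨t, ht⟩ := hne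
  let e := Fintype.equivFin τ
  let L : ℕ → Set (τ → k) := fun i => {x | ∀ j, i ≤ e j → x j = t j}
  have htL (i) : t ∈ L i := fun _ _ => rfl
  have hLc (i) : IsClosed (L i) := by
    have : L i = ⋂ j, ⋂ (_ : i ≤ e j), {x | x j - t j = 0} := by
      ext x; simp [L, sub_eq_zero]
    rw [this]
    refine isClosed_iInter fun j => isClosed_iInter fun _ => ?_
    have h : (fun x : τ → k => x j - t j) ∈ regFun (fun x : τ → k => x) :=
      (regFun (fun x : τ → k => x)).sub_mem (coord_mem_regFun (fun x : τ → k => x) j)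
        (const_mem_regFun (fun x : τ → k => x) (t j))
    exact isClosed_zeros_of_mem_regFun isInducing_id_affine h
  have hLi (i) : IsIrreducible (L i) := by
    let f : (τ → k) → (τ → k) := fun x j => if i ≤ e j then t j else x j
    have hf : Continuous f := by
      refine continuous_of_mem_regFun isInducing_id_affine isInducing_id_affine fun j => ?_
      by_cases hj : i ≤ e j
      · simpa [f, hj] using const_mem_regFun (fun x : τ → k => x) (t j)
      · simpa [f, hj] using coord_mem_regFun (fun x : τ → k => x) j
    have : L i = f '' Set.univ := by
      ext x
      simp only [L, Set.mem_ofPred_eq, Set.image_univ, Set.mem_range]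
      constructor
      · intro h
        refine ⟨x, funext fun j => ?_⟩
        by_cases hj : i ≤ e j
        · simp [f, hj, h j hj]
        · simp [f, hj]
      · rintro ⟨y, rfl⟩ j hj
        simp [f, hj]
    rw [this]
    exact (IrreducibleSpace.isIrreducible_univ _).image _ hf.continuousOn
  let C : ℕ → TopologicalSpace.IrreducibleCloseds U := fun i =>
    ⟨Subtype.val ⁻¹' L i,
      (hLi i).preimage hU.isOpenEmbedding_subtypeVal ⟨t, htL i, by simpa using ht⟩,
      (hLc i).preimage continuous_subtype_val⟩
  have hlt : ∀ i < Fintype.card τ, C i < C (i + 1) := by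
    intro i hi
    have hle : C i ≤ C (i + 1) := fun x hx j hj => hx j (by omega)
    refine lt_of_le_of_ne hle fun h => ?_
    -- The part of `L (i + 1)` in `U` is dense in it, so equal traces on `U` would force this
    -- inclusion; moving `t` in the coordinate numbered `i` refutes it.
    have h1 : L (i + 1) ⊆ L i := by
      refine (subset_closure_inter_of_isPreirreducible_of_isOpen
        (hLi (i + 1)).isPreirreducible hU ⟨t, htL _, ht⟩).trans (closure_minimal ?_ (hLc i))
      rintro x ⟨hx, hxU⟩
      have : (⟨x, hxU⟩ : U) ∈ C (i + 1) := hx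
      rw [← h] at this
      exact this
    obtain ⟨j, hj⟩ := e.surjective ⟨i, hi⟩
    have h2 : Function.update t j (t j + 1) ∈ L (i + 1) := by
      intro l hl
      have : l ≠ j := by
        rintro rfl
        rw [hj] at hl
        simp at hl
      simp [this]
    have := h1 h2 j (by simp [hj])
    simp at this
  exact Order.LTSeries.length_le_krullDim
    (⟨Fintype.card τ, fun i => C i, fun i => hlt i i.2⟩ : LTSeries _)

/-- An open subset of an affine space of dimension `d` that is mapped to a space `Y`, such that the
coordinates can be recovered by regular functions on the image, shows that the image has dimension
at least `d`. -/
theorem card_le_topologicalKrullDim_of_leftInverse [Infinite k] [Fintype σ] {U : Set (σ → k)}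
    (hU : IsOpen U) (hne : U.Nonempty) [TopologicalSpace Y] (hιY : IsInducing ιY) {f : U → Y}
    (hf : Continuous f) {v : σ → Y → k}
    (hv : ∀ s, (fun y : Set.range f => v s y) ∈ regFun fun y : Set.range f => ιY y)
    (hvf : ∀ t s, v s (f t) = t.1 s) {T : Set Y} (hT : Set.range f ⊆ T) :
    ((Fintype.card σ : ℕ) : WithBot ℕ∞) ≤ topologicalKrullDim T := by
  let g : Set.range f → U := fun y => ⟨fun s => v s y, by
    obtain ⟨_, t, rfl⟩ := y
    have : (fun s => v s (f t)) = t.1 := funext fun s => hvf t s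
    rw [this]
    exact t.2⟩
  have hg : Continuous g :=
    continuous_of_mem_regFun (isInducing_restrict hιY _)
      (isInducing_restrict isInducing_id_affine U) hv
  have hgf : Function.LeftInverse g (Set.rangeFactorization f) := fun t =>
    Subtype.ext (funext fun s => hvf t s)
  -- A continuous map with a continuous left inverse is an embedding, so the image is at least as
  -- large in dimension as `U`.
  have h1 : IsInducing (Set.rangeFactorization f) :=
    (hgf.isEmbedding hg (hf.subtype_mk _)).isInducing
  exact (card_le_topologicalKrullDim_of_isOpen hU hne).trans
    ((IsEmbedding.inclusion hT).isInducing.comp h1).topologicalKrullDim_le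

theorem regFun_noZeroDivisors [TopologicalSpace X] [IrreducibleSpace X] (hι : IsInducing ι) :
    NoZeroDivisors (regFun ι) where
  eq_zero_or_eq_zero_of_mul_eq_zero := by
    rintro ⟨u, hu⟩ ⟨v, hv⟩ huv
    have huv : ∀ x, u x * v x = 0 := fun x => congrFun (congrArg Subtype.val huv) x
    have := isPreirreducible_iff_isClosed_union_isClosed.1
      (IrreducibleSpace.isIrreducible_univ X).isPreirreducible _ _
      (isClosed_zeros_of_mem_regFun hι hu) (isClosed_zeros_of_mem_regFun hι hv)
      (fun x _ => by simpa using huv x)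
    refine this.imp (fun h => ?_) (fun h => ?_)
    · ext x; exact h (Set.mem_univ x)
    · ext x; exact h (Set.mem_univ x)

theorem eq_zero_of_C_mul_X_sub_C_eq_zero {R : Type*} [CommRing R] {a b : R}
    (h : Polynomial.C a * Polynomial.X - Polynomial.C b = 0) : a = 0 := by
  simpa [Polynomial.coeff_C] using congrArg (fun p => Polynomial.coeff p 1) h

/-- A regular function `P / Q` is a root of `Q * T - P`, hence algebraic over the subalgebra
generated by the coordinates. This polynomial is nonzero because `Q` has no zero on the nonempty
space `X`. -/
theorem trdeg_regFun_le [TopologicalSpace X] [IrreducibleSpace X] (hι : IsInducing ι)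
    [Fintype σ] : Algebra.trdeg k (regFun ι) ≤ (Fintype.card σ : ℕ) := by
  have := regFun_noZeroDivisors hι
  let c : σ → regFun ι := fun s => ⟨fun x => ι x s, coord_mem_regFun ι s⟩
  have hc (P : MvPolynomial σ k) (x : X) : (aeval c P : regFun ι).1 x = eval (ι x) P := by
    have : (((Pi.evalAlgHom k (fun _ : X => k) x).comp (regFun ι).val).comp (aeval c))
        = aeval (ι x) := by
      ext t; simp [c]
    simpa [aeval_eq_eval] using congrArg (fun φ => φ P) this
  have hmem (P : MvPolynomial σ k) : aeval c P ∈ Algebra.adjoin k (Set.range c) := by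
    rw [Algebra.adjoin_range_eq_range_aeval]; exact ⟨P, rfl⟩
  have halg : Algebra.IsAlgebraic (Algebra.adjoin k (Set.range c)) (regFun ι) := by
    refine ⟨fun u => ?_⟩
    obtain ⟨P, Q, h⟩ := u.2
    obtain ⟨x0⟩ := (inferInstance : Nonempty X)
    refine ⟨Polynomial.C ⟨aeval c Q, hmem Q⟩ * Polynomial.X - Polynomial.C ⟨aeval c P, hmem P⟩,
      fun h0 => ?_, ?_⟩
    · have := congrFun (congrArg (fun v => v.1.1) (eq_zero_of_C_mul_X_sub_C_eq_zero h0)) x0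
      exact (h x0).1 ((hc Q x0).symm.trans this)
    · ext x
      simp [Subalgebra.smul_def, Algebra.algebraMap_eq_smul_one, hc]
      rw [← (h x).2]; ring
  refine (Algebra.IsAlgebraic.trdeg_le_cardinalMk k (Set.range c)).trans ?_
  have : Finite (Set.range c) := Set.finite_range c
  rw [← Nat.cast_card, Nat.cast_le, Nat.card_coe_set_eq]
  rw [← Nat.card_eq_fintype_card, ← Set.ncard_univ, ← Set.image_univ]
  exact Set.ncard_image_le Set.finite_univ

/-- By Noether normalization `A` is integral over a polynomial ring in `s` variables. These
variables remain algebraically independent in `B`, so `s ≤ d`, and incomparability of primes in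
integral extensions bounds the dimension of `A` by `s`. -/
theorem ringKrullDim_le_of_injective_algHom {A B : Type*} [CommRing A] [Nontrivial A] [Algebra k A]
    [Algebra.FiniteType k A] [CommRing B] [Algebra k B] (φ : A →ₐ[k] B)
    (hφ : Function.Injective φ) {d : ℕ} (hd : Algebra.trdeg k B ≤ d) : ringKrullDim A ≤ d := by
  obtain ⟨s, g, hg, hint⟩ := exists_integral_inj_algHom_of_fg k A
  have hs : s ≤ d := by
    have h1 : AlgebraicIndependent k fun i : Fin s => φ (g (X i)) := by
      have : (aeval fun i : Fin s => φ (g (X i))) = φ.comp g := by ext; simp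
      rw [AlgebraicIndependent, this]
      exact hφ.comp hg
    have h2 := h1.lift_cardinalMk_le_trdeg
    rw [Cardinal.mk_fin, Cardinal.lift_natCast, Cardinal.lift_id'] at h2
    exact_mod_cast h2.trans hd
  have h2 : ringKrullDim A ≤ ringKrullDim (MvPolynomial (Fin s) k) := by
    algebraize [g.toRingHom]
    refine Order.krullDim_le_of_strictMono
      (PrimeSpectrum.comap (algebraMap (MvPolynomial (Fin s) k) A)) fun p q hpq => ?_
    exact Ideal.IsIntegral.comap_lt_comap hpq
  refine h2.trans ?_
  rw [MvPolynomial.ringKrullDim_of_isNoetherianRing, ringKrullDim_eq_zero_of_field, zero_add]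
  simpa using hs

/-- Polynomials on `Y` pulled back along `f` form a finitely generated algebra `A` inside `regFun
ι`. Sending a point to the kernel of evaluation embeds the topology of `Z` in `Spec A`, whose
dimension is at most the transcendence degree of `regFun ι`. -/
theorem topologicalKrullDim_le_card_of_subset_closure_range [TopologicalSpace X]
    [IrreducibleSpace X] (hι : IsInducing ι) [Fintype σ] [TopologicalSpace Y] (hιY : IsInducing ιY)
    [Finite τ] {f : X → Y} (hf : ∀ t, (fun x => ιY (f x) t) ∈ regFun ι) {Z : Set Y}
    (hZ : Z ⊆ closure (Set.range f)) :
    topologicalKrullDim Z ≤ ((Fintype.card σ : ℕ) : WithBot ℕ∞) := by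
  let φ : MvPolynomial τ k →ₐ[k] regFun ι := aeval fun t => ⟨fun x => ιY (f x) t, hf t⟩
  have hφ (P : MvPolynomial τ k) (x : X) : (φ P).1 x = eval (ιY (f x)) P := by
    have : (((Pi.evalAlgHom k (fun _ : X => k) x).comp (regFun ι).val).comp φ)
        = aeval (ιY (f x)) := by
      ext t; simp [φ]
    simpa [aeval_eq_eval] using congrArg (fun φ => φ P) this
  have hker (y : Z) : ∀ p ∈ RingHom.ker φ, aeval (ιY y) p = 0 := by
    intro p hp
    have hc : IsClosed {y : Y | eval (ιY y) p = 0} :=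
      isClosed_zeros_of_mem_regFun hιY (eval_comp_mem_regFun (coord_mem_regFun ιY) p)
    refine closure_minimal ?_ hc (hZ y.2)
    rintro _ ⟨x, rfl⟩
    rw [Set.mem_ofPred_eq, ← hφ, hp]; rfl
  let A := MvPolynomial τ k ⧸ RingHom.ker φ
  let ev (y : Z) : A →ₐ[k] k := Ideal.Quotient.liftₐ _ (aeval (ιY y)) (hker y)
  let j (y : Z) : PrimeSpectrum A := ⟨RingHom.ker (ev y), RingHom.ker_isPrime _⟩
  -- It is easier to compare topologies in the spectrum of the polynomial ring, where zero sets and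
  -- zero loci correspond directly; the closed immersion of `Spec A` then transfers the result to
  -- `j`.
  have hpt : IsInducing fun y : Z =>
      PrimeSpectrum.comap (Ideal.Quotient.mk (RingHom.ker φ)) (j y) := by
    have hmem (y : Z) (p : MvPolynomial τ k) :
        p ∈ (PrimeSpectrum.comap (Ideal.Quotient.mk (RingHom.ker φ)) (j y)).asIdeal ↔
          eval (ιY y) p = 0 := by
      change aeval (ιY y) p = 0 ↔ _
      simp [aeval_eq_eval]
    refine ⟨TopologicalSpace.ext_isClosed fun T => ?_⟩
    rw [isClosed_induced_iff (f := fun y : Z =>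
        PrimeSpectrum.comap (Ideal.Quotient.mk (RingHom.ker φ)) (j y)),
      (hιY.comp IsInducing.subtypeVal).isClosed_iff]
    constructor
    · rintro ⟨V, hV, rfl⟩
      obtain ⟨S, rfl⟩ := isClosed_iff_exists_zeroSet.1 hV
      refine ⟨_, PrimeSpectrum.isClosed_zeroLocus S, ?_⟩
      ext y
      simp only [Set.mem_preimage, PrimeSpectrum.mem_zeroLocus, Set.subset_def, SetLike.mem_coe,
        hmem]
      rfl
    · rintro ⟨V, hV, rfl⟩
      obtain ⟨S, rfl⟩ := (PrimeSpectrum.isClosed_iff_zeroLocus _).1 hV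
      refine ⟨_, isClosed_iff_exists_zeroSet.2 ⟨S, rfl⟩, ?_⟩
      ext y
      simp only [Set.mem_preimage, PrimeSpectrum.mem_zeroLocus, Set.subset_def, SetLike.mem_coe,
        hmem]
      rfl
  have hj : IsInducing j :=
    (PrimeSpectrum.comap_isInducing_of_surjective _ _
      Ideal.Quotient.mk_surjective).of_comp_iff.1 hpt
  have : Nontrivial (regFun ι) := by
    obtain ⟨x0⟩ := (inferInstance : Nonempty X)
    exact ⟨0, 1, fun h => zero_ne_one (congrFun (congrArg Subtype.val h) x0)⟩
  have : Nontrivial A := Ideal.Quotient.nontrivial_iff.2 (RingHom.ker_ne_top _)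
  refine hj.topologicalKrullDim_le.trans ?_
  rw [PrimeSpectrum.topologicalKrullDim_eq_ringKrullDim]
  exact ringKrullDim_le_of_injective_algHom (Ideal.kerLiftAlg φ) (Ideal.kerLiftAlg_injective φ)
    (trdeg_regFun_le hι)

end Zariski

/-! ### Matrix operations preserving regularity of the entries. -/

section RegularMatrices

variable {k : Type*} [Field k] {σ X : Type*} {ι : X → σ → k}

/-- Matrix-valued functions with regular entries. -/
def IsRegMat {a b : Type*} (ι : X → σ → k) (A : X → Matrix a b k) : Prop :=
  ∀ i j, (fun x => A x i j) ∈ regFun ι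

variable {a b c d : Type*}

theorem IsRegMat.const (A : Matrix a b k) : IsRegMat ι fun _ => A :=
  fun i j => const_mem_regFun ι (A i j)

theorem IsRegMat.neg {A : X → Matrix a b k} (hA : IsRegMat ι A) : IsRegMat ι fun x => -A x :=
  fun i j => (regFun ι).neg_mem (hA i j)

theorem IsRegMat.mul [Fintype b] {A : X → Matrix a b k} {B : X → Matrix b c k}
    (hA : IsRegMat ι A) (hB : IsRegMat ι B) : IsRegMat ι fun x => A x * B x := by
  intro i j
  have : (fun x => (A x * B x) i j) = ∑ l, (fun x => A x i l) * fun x => B x l j := by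
    ext x; simp [Matrix.mul_apply]
  rw [this]
  exact Subalgebra.sum_mem _ fun l _ => (regFun ι).mul_mem (hA i l) (hB l j)

theorem IsRegMat.submatrix {A : X → Matrix a b k} (hA : IsRegMat ι A) (e : c → a) (f : d → b) :
    IsRegMat ι fun x => (A x).submatrix e f :=
  fun i j => hA (e i) (f j)

theorem IsRegMat.fromBlocks {A : X → Matrix a b k} {B : X → Matrix a d k} {C : X → Matrix c b k}
    {D : X → Matrix c d k} (hA : IsRegMat ι A) (hB : IsRegMat ι B) (hC : IsRegMat ι C)
    (hD : IsRegMat ι D) : IsRegMat ι fun x => Matrix.fromBlocks (A x) (B x) (C x) (D x) := by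
  rintro (i | i) (j | j)
  exacts [hA i j, hB i j, hC i j, hD i j]

variable [Fintype a] [DecidableEq a]

theorem IsRegMat.pow {A : X → Matrix a a k} (hA : IsRegMat ι A) (n : ℕ) :
    IsRegMat ι fun x => A x ^ n := by
  induction n with
  | zero => simpa using IsRegMat.const 1
  | succ n ih => simpa only [pow_succ] using ih.mul hA

theorem IsRegMat.det {A : X → Matrix a a k} (hA : IsRegMat ι A) :
    (fun x => (A x).det) ∈ regFun ι := by
  have : (fun x => (A x).det) = ∑ s : Equiv.Perm a, (fun _ => ((Equiv.Perm.sign s : ℤ) : k)) *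
      ∏ i, fun x => A x (s i) i := by
    ext x; simp [Matrix.det_apply']
  rw [this]
  exact Subalgebra.sum_mem _ fun s _ => (regFun ι).mul_mem (const_mem_regFun ι _)
    (Subalgebra.prod_mem _ fun i _ => hA _ _)

theorem IsRegMat.inv {A : X → Matrix a a k} (hA : IsRegMat ι A) (h0 : ∀ x, (A x).det ≠ 0) :
    IsRegMat ι fun x => (A x)⁻¹ := by
  intro i j
  have hadj : (fun x => (A x).adjugate i j) ∈ regFun ι := by
    simp only [Matrix.adjugate_apply]
    refine IsRegMat.det fun l l' => ?_
    by_cases hl : l = j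
    · subst hl; simpa using const_mem_regFun ι _
    · simpa [Matrix.updateRow_ne hl] using hA l l'
  have : (fun x => (A x)⁻¹ i j) = (fun x => ((A x).det)⁻¹) * fun x => (A x).adjugate i j := by
    ext x; simp [Matrix.inv_def]
  rw [this]
  exact (regFun ι).mul_mem (inv_mem_regFun hA.det h0) hadj

end RegularMatrices

/-! ### Coordinates on tuples and nilpotency in degree `n`. -/

section MatTuple

variable {k : Type*} [Field k] {n r : ℕ} {σ X : Type*} {ι : X → σ → k}

theorem isInducing_coords : IsInducing (MatTuple.coords : MatTuple n r k → _) := ⟨rfl⟩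

theorem isRegMat_coords (F : X → MatTuple n r k) (i : Fin r) :
    IsRegMat (fun x => (F x).coords) fun x => F x i :=
  fun a b => coord_mem_regFun (fun x => (F x).coords) (i, a, b)

theorem coords_mem_regFun {F : X → MatTuple n r k} (hF : ∀ i, IsRegMat ι fun x => F x i)
    (s : Fin r × Fin n × Fin n) : (fun x => (F x).coords s) ∈ regFun ι :=
  hF s.1 s.2.1 s.2.2

theorem isOpen_det_ne_zero [TopologicalSpace X] (hι : IsInducing ι) {a : Type*} [Fintype a]
    [DecidableEq a] {A : X → Matrix a a k} (hA : IsRegMat ι A) : IsOpen {x | (A x).det ≠ 0} :=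
  (isClosed_zeros_of_mem_regFun hι hA.det).isOpen_compl

theorem pow_eq_zero_of_isNilpotent_matrix {x : Matrix (Fin n) (Fin n) k} (hx : IsNilpotent x) :
    x ^ n = 0 := by
  have h1 : IsNilpotent (Matrix.toLin' x) := hx.map (Matrix.toLinAlgEquiv' (R := k) (n := Fin n))
  have h2 := h1.charpoly_eq_X_pow_finrank
  have h3 := (Matrix.toLin' x).aeval_self_charpoly
  rw [h2, map_pow, Polynomial.aeval_X, ← Matrix.toLin'_pow] at h3
  exact Matrix.toLin'.injective (by simpa using h3)

end MatTuple

/-! ### The Jordan block, its nilpotent centralizer and Krylov matrices. -/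

section Jordan

variable {k : Type*} [Field k] {m : ℕ}

theorem xReg_pow_apply (a : ℕ) (i j : Fin (m + 1)) :
    (xReg (m + 1) k ^ a) i j = if (i : ℕ) + a = j then 1 else 0 := by
  induction a generalizing i j with
  | zero => simp [Matrix.one_apply, Fin.ext_iff]
  | succ a ih =>
    rw [pow_succ, Matrix.mul_apply]
    simp only [ih]
    simp only [xReg, Matrix.of_apply, mul_ite, mul_one, mul_zero]
    by_cases h : (i : ℕ) + (a + 1) = j
    · rw [if_pos h, Finset.sum_eq_single ⟨i + a, by omega⟩]
      · simp; omega
      · intro l _ hl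
        rw [if_neg]
        intro hlj
        exact hl (Fin.ext (by simp; omega))
      · simp
    · rw [if_neg h]
      refine Finset.sum_eq_zero fun l _ => ?_
      split_ifs <;> first | rfl | omega

theorem isNilpotent_xReg : IsNilpotent (xReg (m + 1) k) := by
  refine ⟨m + 1, ?_⟩
  ext i j
  have := j.isLt
  rw [xReg_pow_apply, if_neg (by omega), Matrix.zero_apply]

/-- The matrix whose rows are the first rows of the powers of `x`. -/
def krylov (x : Matrix (Fin (m + 1)) (Fin (m + 1)) k) : Matrix (Fin (m + 1)) (Fin (m + 1)) k :=
  Matrix.of fun a j => (x ^ (a : ℕ)) 0 j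

theorem krylov_zero (x : Matrix (Fin (m + 1)) (Fin (m + 1)) k) (j : Fin (m + 1)) :
    krylov x 0 j = (1 : Matrix (Fin (m + 1)) (Fin (m + 1)) k) 0 j := by
  simp [krylov]

theorem krylov_xReg : krylov (xReg (m + 1) k) = 1 := by
  ext a j
  simp [krylov, xReg_pow_apply, Matrix.one_apply, Fin.ext_iff]

theorem IsRegMat.krylov {σ X : Type*} {ι : X → σ → k}
    {A : X → Matrix (Fin (m + 1)) (Fin (m + 1)) k} (hA : IsRegMat ι A) :
    IsRegMat ι fun x => krylov (A x) :=
  fun a j => hA.pow a 0 j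

/-- Consequently a matrix commuting with the Jordan block is determined by its first row. -/
theorem xReg_mul_apply_zero_pow (y : Matrix (Fin (m + 1)) (Fin (m + 1)) k) (i j : Fin (m + 1)) :
    (xReg (m + 1) k ^ (i : ℕ) * y) 0 j = y i j := by
  simp [Matrix.mul_apply, xReg_pow_apply, ← Fin.ext_iff]

/-- Multiplication by `x` shifts the rows `e₀ x^a` by one, and the last row goes to zero because `x
^ (m + 1) = 0`. When `krylov x` is invertible, it therefore conjugates `x` to the Jordan block. -/
theorem krylov_mul (x : Matrix (Fin (m + 1)) (Fin (m + 1)) k) (hx : IsNilpotent x) :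
    krylov x * x = xReg (m + 1) k * krylov x := by
  ext a j
  have h1 : (krylov x * x) a j = (x ^ ((a : ℕ) + 1)) 0 j := by
    rw [pow_succ, Matrix.mul_apply, Matrix.mul_apply]; rfl
  rw [h1, Matrix.mul_apply]
  simp only [xReg, Matrix.of_apply, krylov, ite_mul, one_mul, zero_mul]
  by_cases h : (a : ℕ) + 1 < m + 1
  · rw [Finset.sum_eq_single ⟨a + 1, h⟩]
    · simp
    · intro l _ hl
      rw [if_neg]
      intro h'
      exact hl (Fin.ext h'.symm)
    · simp
  · rw [show (a : ℕ) + 1 = m + 1 by omega, pow_eq_zero_of_isNilpotent_matrix hx]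
    refine (Finset.sum_eq_zero fun l _ => ?_).symm
    have := l.isLt
    rw [if_neg (by omega)]

/-- The strictly upper triangular Toeplitz matrix with first row `(0, c)`. -/
def toeplitz (c : Fin m → k) : Matrix (Fin (m + 1)) (Fin (m + 1)) k :=
  ∑ a, c a • xReg (m + 1) k ^ ((a : ℕ) + 1)

theorem toeplitz_zero_succ (c : Fin m → k) (a : Fin m) : toeplitz c 0 a.succ = c a := by
  simp [toeplitz, Matrix.sum_apply, xReg_pow_apply, ← Fin.ext_iff]

theorem commute_xReg_toeplitz (c : Fin m → k) : Commute (xReg (m + 1) k) (toeplitz c) :=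
  Commute.sum_right _ _ _ fun _ _ => ((Commute.refl _).pow_right _).smul_right _

theorem commute_toeplitz (c d : Fin m → k) : Commute (toeplitz c) (toeplitz d) :=
  Commute.sum_left _ _ _ fun _ _ => ((commute_xReg_toeplitz d).pow_left _).smul_left _

theorem isNilpotent_toeplitz (c : Fin m → k) : IsNilpotent (toeplitz c) := by
  have : toeplitz c = xReg (m + 1) k * ∑ a, c a • xReg (m + 1) k ^ (a : ℕ) := by
    simp [toeplitz, Finset.mul_sum, pow_succ']
  rw [this]
  refine Commute.isNilpotent_mul_right ?_ isNilpotent_xReg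
  exact Commute.sum_right _ _ _ fun _ _ => ((Commute.refl _).pow_right _).smul_right _

theorem eq_smul_one_add_toeplitz {y : Matrix (Fin (m + 1)) (Fin (m + 1)) k}
    (hy : Commute (xReg (m + 1) k) y) : y = y 0 0 • 1 + toeplitz fun a => y 0 a.succ := by
  set z := y 0 0 • 1 + toeplitz fun a => y 0 a.succ with hz
  have hzc : Commute (xReg (m + 1) k) z :=
    ((Commute.one_right _).smul_right _).add_right (commute_xReg_toeplitz _)
  have h0 : ∀ j, y 0 j = z 0 j := by
    intro j
    refine Fin.cases ?_ (fun a => ?_) j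
    · simp [hz, toeplitz, Matrix.sum_apply, xReg_pow_apply]
    · simp [hz, toeplitz_zero_succ, (Fin.succ_ne_zero a).symm]
  ext i j
  rw [← xReg_mul_apply_zero_pow y, ← xReg_mul_apply_zero_pow z, (hy.pow_left _).eq,
    (hzc.pow_left _).eq, Matrix.mul_apply, Matrix.mul_apply]
  simp only [h0]

/-- The scalar part of `y` is a difference of two commuting nilpotents, so it is nilpotent and
vanishes. -/
theorem eq_toeplitz_of_isNilpotent {y : Matrix (Fin (m + 1)) (Fin (m + 1)) k}
    (hy : Commute (xReg (m + 1) k) y) (hn : IsNilpotent y) :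
    y = toeplitz fun a => y 0 a.succ := by
  have h := eq_smul_one_add_toeplitz hy
  suffices h0 : y 0 0 = 0 by simpa [h0] using h
  set T := toeplitz fun a => y 0 a.succ with hT
  have h1 : y - T = y 0 0 • 1 := by rw [sub_eq_iff_eq_add]; exact h
  have h2 : Commute y T := by
    have : Commute (y 0 0 • 1 + T) T :=
      ((Commute.one_left _).smul_left _).add_left (Commute.refl _)
    rwa [← h] at this
  obtain ⟨N, hN⟩ := h2.isNilpotent_sub hn (isNilpotent_toeplitz _)
  rw [h1, smul_pow, one_pow] at hN
  have := congrFun (congrFun hN 0) 0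
  simp only [Matrix.smul_apply, Matrix.one_apply_eq, smul_eq_mul, mul_one, Matrix.zero_apply] at this
  exact eq_zero_of_pow_eq_zero this
end Jordan

/-! ### Parametrization and dimension of the regular part. -/

section RegularPart

variable {k : Type*} [Field k] {m q : ℕ}

/-- The commuting nilpotent tuples for which the first standard row vector is cyclic with respect
to the first matrix. -/
def cyclicLocus (m q : ℕ) (k : Type*) [Field k] : Set (MatTuple (m + 1) (q + 1) k) :=
  {x | x ∈ commutingVariety (q + 1) (nilpotentCone (m + 1) k) ∧ (krylov (x 0)).det ≠ 0}

/-- The parameters of `cyclicLocus`. -/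
abbrev CyclicParam (m q : ℕ) : Type := (Fin m × Fin (m + 1)) ⊕ (Fin q × Fin m)

/-- The matrix with first row `(1, 0, …, 0)` and the other rows prescribed by parameters. -/
def rowMatrix (t : CyclicParam m q → k) : Matrix (Fin (m + 1)) (Fin (m + 1)) k :=
  Matrix.of fun i j => Fin.cases ((1 : Matrix (Fin (m + 1)) (Fin (m + 1)) k) 0 j)
    (fun a => t (Sum.inl (a, j))) i

/-- The parameters for which `rowMatrix` is invertible. -/
def cyclicDomain (m q : ℕ) (k : Type*) [Field k] : Set (CyclicParam m q → k) :=
  {t | (rowMatrix t).det ≠ 0}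

/-- The standard tuple of power series in the Jordan block. -/
def toeplitzTuple (t : CyclicParam m q → k) : MatTuple (m + 1) (q + 1) k :=
  Fin.cases (xReg (m + 1) k) fun i => toeplitz fun a => t (Sum.inr (i, a))

/-- The parametrization of `cyclicLocus`. -/
noncomputable def cyclicTuple (t : CyclicParam m q → k) : MatTuple (m + 1) (q + 1) k :=
  fun i => (rowMatrix t)⁻¹ * toeplitzTuple t i * rowMatrix t

/-- The coordinates of the inverse of `cyclicTuple`. -/
noncomputable def cyclicCoord (s : CyclicParam m q) (x : MatTuple (m + 1) (q + 1) k) : k :=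
  Sum.elim (fun s => krylov (x 0) s.1.succ s.2)
    (fun s => (x s.1.succ * (krylov (x 0))⁻¹) 0 s.2.succ) s

variable {X : Type*} {n r : ℕ}

theorem isRegMat_rowMatrix :
    IsRegMat (fun t : CyclicParam m q → k => t) fun t => rowMatrix t := by
  intro i j
  refine Fin.cases ?_ (fun a => ?_) i
  · exact const_mem_regFun _ _
  · exact coord_mem_regFun (fun t : CyclicParam m q → k => t) (Sum.inl (a, j))

theorem isRegMat_comp {σ a b X Y : Type*} {ι : X → σ → k} {A : X → Matrix a b k}
    (hA : IsRegMat ι A) (f : Y → X) : IsRegMat (fun y => ι (f y)) fun y => A (f y) := by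
  intro i j
  obtain ⟨P, Q, h⟩ := hA i j
  exact ⟨P, Q, fun y => h (f y)⟩

theorem isRegMat_toeplitzTuple (i : Fin (q + 1)) :
    IsRegMat (fun t : CyclicParam m q → k => t) fun t => toeplitzTuple t i := by
  refine Fin.cases (IsRegMat.const _) (fun i => ?_) i
  intro a b
  have : (fun t : CyclicParam m q → k => toeplitzTuple t i.succ a b) =
      ∑ l : Fin m, (fun t => t (Sum.inr (i, l))) * fun _ => (xReg (m + 1) k ^ ((l : ℕ) + 1)) a b := by
    ext t
    simp [toeplitzTuple, toeplitz, Matrix.sum_apply]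
  rw [this]
  exact Subalgebra.sum_mem _ fun l _ => (regFun _).mul_mem
    (coord_mem_regFun (fun t : CyclicParam m q → k => t) (Sum.inr (i, l)))
    (const_mem_regFun _ _)

theorem isRegMat_cyclicTuple (i : Fin (q + 1)) :
    IsRegMat (fun t : cyclicDomain m q k => t.1) fun t => cyclicTuple t.1 i :=
  ((isRegMat_comp isRegMat_rowMatrix Subtype.val).inv fun t => t.2).mul
    (isRegMat_comp (isRegMat_toeplitzTuple i) Subtype.val) |>.mul
    (isRegMat_comp isRegMat_rowMatrix Subtype.val)

theorem cyclicCoord_mem_regFun {F : X → MatTuple (m + 1) (q + 1) k}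
    (hF : ∀ x, (krylov (F x 0)).det ≠ 0) (s : CyclicParam m q) :
    (fun x => cyclicCoord s (F x)) ∈ regFun fun x => (F x).coords := by
  rcases s with s | s
  · exact (isRegMat_coords F 0).krylov _ _
  · exact ((isRegMat_coords F s.1.succ).mul ((isRegMat_coords F 0).krylov.inv hF)) _ _

theorem isOpen_cyclicDomain : IsOpen (cyclicDomain m q k) :=
  isOpen_det_ne_zero isInducing_id_affine isRegMat_rowMatrix

theorem cyclicDomain_nonempty : (cyclicDomain m q k).Nonempty := by
  refine ⟨Sum.elim (fun s => (1 : Matrix (Fin (m + 1)) (Fin (m + 1)) k) s.1.succ s.2) 0, ?_⟩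
  have : rowMatrix (Sum.elim (fun s => (1 : Matrix (Fin (m + 1)) (Fin (m + 1)) k) s.1.succ s.2)
      (0 : Fin q × Fin m → k)) = 1 := by
    ext i j
    refine Fin.cases ?_ (fun a => ?_) i <;> rfl
  simp only [cyclicDomain, Set.mem_ofPred_eq, this]
  simp

/-- A matrix with first row `e₀` preserves first rows under left multiplication, hence so does its
inverse. This normalization makes the parameters recoverable from the conjugated tuple. -/
theorem inv_mul_apply_zero {H : Matrix (Fin (m + 1)) (Fin (m + 1)) k} (hd : H.det ≠ 0)
    (h0 : ∀ j, H 0 j = (1 : Matrix (Fin (m + 1)) (Fin (m + 1)) k) 0 j)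
    (A : Matrix (Fin (m + 1)) (Fin (m + 1)) k) (j : Fin (m + 1)) : (H⁻¹ * A) 0 j = A 0 j := by
  have h1 (B : Matrix (Fin (m + 1)) (Fin (m + 1)) k) : (H * B) 0 j = B 0 j := by
    rw [Matrix.mul_apply]
    simp [h0, Matrix.one_apply]
  rw [← h1 (H⁻¹ * A), Matrix.mul_nonsing_inv_cancel_left _ _ (isUnit_iff_ne_zero.2 hd)]

theorem rowMatrix_zero (t : CyclicParam m q → k) (j : Fin (m + 1)) :
    rowMatrix t 0 j = (1 : Matrix (Fin (m + 1)) (Fin (m + 1)) k) 0 j := rfl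

theorem inv_mul_mul_pow {H : Matrix (Fin n) (Fin n) k} (hd : H.det ≠ 0)
    (A : Matrix (Fin n) (Fin n) k) (a : ℕ) : (H⁻¹ * A * H) ^ a = H⁻¹ * A ^ a * H := by
  have hu := isUnit_iff_ne_zero.2 hd
  induction a with
  | zero => simp [Matrix.nonsing_inv_mul _ hu]
  | succ a ih =>
    rw [pow_succ, ih, pow_succ]
    simp only [Matrix.mul_assoc]
    rw [Matrix.mul_nonsing_inv_cancel_left _ _ hu]

theorem commute_inv_mul_mul {H : Matrix (Fin n) (Fin n) k} (hd : H.det ≠ 0)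
    {A B : Matrix (Fin n) (Fin n) k} (h : Commute A B) :
    Commute (H⁻¹ * A * H) (H⁻¹ * B * H) := by
  have hu := isUnit_iff_ne_zero.2 hd
  have key (A B : Matrix (Fin n) (Fin n) k) :
      (H⁻¹ * A * H) * (H⁻¹ * B * H) = H⁻¹ * (A * B) * H := by
    simp only [Matrix.mul_assoc]
    rw [Matrix.mul_nonsing_inv_cancel_left _ _ hu]
  rw [Commute, SemiconjBy, key, key, h.eq]

theorem isNilpotent_inv_mul_mul {H : Matrix (Fin n) (Fin n) k} (hd : H.det ≠ 0)
    {A : Matrix (Fin n) (Fin n) k} (h : IsNilpotent A) : IsNilpotent (H⁻¹ * A * H) := by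
  obtain ⟨N, hN⟩ := h
  exact ⟨N, by rw [inv_mul_mul_pow hd, hN, Matrix.mul_zero, Matrix.zero_mul]⟩

theorem krylov_cyclicTuple {t : CyclicParam m q → k} (ht : t ∈ cyclicDomain m q k) :
    krylov (cyclicTuple t 0) = rowMatrix t := by
  ext a j
  rw [krylov, Matrix.of_apply, cyclicTuple, inv_mul_mul_pow ht, Matrix.mul_assoc,
    inv_mul_apply_zero ht (rowMatrix_zero t)]
  exact xReg_mul_apply_zero_pow _ _ _

theorem cyclicTuple_mem_cyclicLocus {t : CyclicParam m q → k} (ht : t ∈ cyclicDomain m q k) :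
    cyclicTuple t ∈ cyclicLocus m q k := by
  refine ⟨⟨fun i => isNilpotent_inv_mul_mul ht ?_, fun i j => commute_inv_mul_mul ht ?_⟩, ?_⟩
  · exact Fin.cases isNilpotent_xReg (fun i => isNilpotent_toeplitz _) i
  · refine Fin.cases ?_ (fun i => ?_) i <;> refine Fin.cases ?_ (fun j => ?_) j
    exacts [Commute.refl _, commute_xReg_toeplitz _, (commute_xReg_toeplitz _).symm,
      commute_toeplitz _ _]
  · rw [krylov_cyclicTuple ht]; exact ht

theorem cyclicCoord_cyclicTuple {t : CyclicParam m q → k} (ht : t ∈ cyclicDomain m q k)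
    (s : CyclicParam m q) : cyclicCoord s (cyclicTuple t) = t s := by
  rcases s with s | s
  · simp only [cyclicCoord, Sum.elim_inl, krylov_cyclicTuple ht]; rfl
  · simp only [cyclicCoord, Sum.elim_inr, krylov_cyclicTuple ht]
    rw [cyclicTuple, Matrix.mul_nonsing_inv_cancel_right _ _ (isUnit_iff_ne_zero.2 ht),
      inv_mul_apply_zero ht (rowMatrix_zero t)]
    exact toeplitz_zero_succ _ _

/-- Conjugation by `krylov (x 0)` turns `x 0` into the Jordan block and the other entries into
nilpotents commuting with it, which are Toeplitz. -/
theorem exists_cyclicTuple_eq {x : MatTuple (m + 1) (q + 1) k} (hx : x ∈ cyclicLocus m q k) :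
    ∃ t ∈ cyclicDomain m q k, cyclicTuple t = x := by
  obtain ⟨⟨hnil, hcomm⟩, hd⟩ := hx
  have hu := isUnit_iff_ne_zero.2 hd
  have hrow : rowMatrix (fun s => cyclicCoord s x) = krylov (x 0) := by
    ext i j
    refine Fin.cases ?_ (fun a => ?_) i
    · exact (krylov_zero _ _).symm
    · rfl
  refine ⟨fun s => cyclicCoord s x, ?_, ?_⟩
  · rw [cyclicDomain, Set.mem_ofPred_eq, hrow]; exact hd
  have hJ := krylov_mul (x 0) (hnil 0)
  set H := krylov (x 0) with hH
  have hHu : IsUnit (H⁻¹).det := Matrix.isUnit_nonsing_inv_det _ hu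
  have hJ' : xReg (m + 1) k = H * x 0 * H⁻¹ := by
    rw [hJ, Matrix.mul_nonsing_inv_cancel_right _ _ hu]
  have hinv : (H⁻¹)⁻¹ = H := Matrix.nonsing_inv_nonsing_inv _ hu
  have hy (i) : toeplitzTuple (fun s => cyclicCoord s x) i = H * x i * H⁻¹ := by
    refine Fin.cases hJ' (fun i => ?_) i
    have hc := commute_inv_mul_mul hHu.ne_zero (hcomm 0 i.succ)
    have hn := isNilpotent_inv_mul_mul hHu.ne_zero (hnil i.succ)
    rw [hinv] at hc hn
    rw [← hJ'] at hc
    rw [eq_toeplitz_of_isNilpotent hc hn]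
    change toeplitz _ = _
    congr 1
    ext a
    simp only [cyclicCoord, Sum.elim_inr, ← hH]
    conv_rhs => rw [Matrix.mul_assoc]
    rw [Matrix.mul_apply (M := H)]
    simp [hH, krylov_zero, Matrix.one_apply]
  funext i
  rw [cyclicTuple, hrow, hy]
  simp only [Matrix.mul_assoc]
  rw [Matrix.nonsing_inv_mul_cancel_left _ _ hu, Matrix.nonsing_inv_mul _ hu, Matrix.mul_one]

theorem range_cyclicTuple :
    Set.range (fun t : cyclicDomain m q k => cyclicTuple t.1) = cyclicLocus m q k := by
  ext x
  constructor
  · rintro ⟨t, rfl⟩; exact cyclicTuple_mem_cyclicLocus t.2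
  · intro hx
    obtain ⟨t, ht, rfl⟩ := exists_cyclicTuple_eq hx
    exact ⟨⟨t, ht⟩, rfl⟩

/-- An irreducible set that is open in `C` is contained in an irreducible component of `C` whose
dimension is at most that of its closure. -/
theorem exists_irreducibleComponent_le_closure {Y : Type*} [TopologicalSpace Y] {C O : Set Y}
    (hOC : O ⊆ C) (hO : IsIrreducible O) (hopen : IsOpen (Subtype.val ⁻¹' O : Set C)) :
    ∃ Z ∈ irreducibleComponents C, topologicalKrullDim Z ≤ topologicalKrullDim (closure O) := by
  have hO' : IsIrreducible (Subtype.val ⁻¹' O : Set C) := by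
    have := Subtype.irreducibleSpace hO
    have h : (Subtype.val ⁻¹' O : Set C) = Set.range (Set.inclusion hOC) :=
      (Set.range_inclusion hOC).symm
    rw [h, ← Set.image_univ]
    exact (IrreducibleSpace.isIrreducible_univ O).image _ (continuous_inclusion hOC).continuousOn
  obtain ⟨Z, hZ, hOZ⟩ := exists_mem_irreducibleComponents_subset_of_isIrreducible _ hO'
  obtain ⟨y, hy⟩ := hO'.nonempty
  -- A nonempty open part of the irreducible set `Z` is dense in it, so `Z` lies in the closure of
  -- `O`.
  have hsub := subset_closure_inter_of_isPreirreducible_of_isOpen hZ.1.isPreirreducible hopen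
    ⟨y, hOZ hy, hy⟩
  have hmem (z : Z) : z.1.1 ∈ closure O :=
    closure_mono (by rintro _ ⟨x, ⟨-, hx⟩, rfl⟩; exact hx)
      (image_closure_subset_closure_image continuous_subtype_val ⟨_, hsub z.2, rfl⟩)
  have hind : IsInducing fun z : Z => (⟨z.1.1, hmem z⟩ : closure O) :=
    (IsInducing.subtypeVal (t := closure O)).of_comp_iff.1
      ((IsInducing.subtypeVal (t := C)).comp (IsInducing.subtypeVal (t := Z)))
  exact ⟨Z, hZ, hind.topologicalKrullDim_le⟩

theorem isOpen_irreducibleSpace [Infinite k] {σ : Type*} {U : Set (σ → k)} (hU : IsOpen U)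
    (hne : U.Nonempty) : IrreducibleSpace U :=
  haveI : Nonempty U := hne.to_subtype
  hU.isOpenEmbedding_subtypeVal.irreducibleSpace

theorem isRegularNilpotent_of_mem_cyclicLocus {x : MatTuple (m + 1) (q + 1) k}
    (hx : x ∈ cyclicLocus m q k) : IsRegularNilpotent (x 0) := by
  obtain ⟨t, ht, rfl⟩ := exists_cyclicTuple_eq hx
  let g : GL (Fin (m + 1)) k := Matrix.GeneralLinearGroup.mkOfDetNeZero (rowMatrix t) ht
  refine ⟨g⁻¹, ?_⟩
  rw [inv_inv, Matrix.coe_units_inv]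
  rfl

theorem conj_mem_commutingVariety {x : MatTuple n r k} (g : GL (Fin n) k)
    (hx : x ∈ commutingVariety r (nilpotentCone n k)) :
    conj g x ∈ commutingVariety r (nilpotentCone n k) := by
  have hd : ((g⁻¹ : GL (Fin n) k) : Matrix (Fin n) (Fin n) k).det ≠ 0 :=
    ((Matrix.isUnit_iff_isUnit_det _).1 (Units.isUnit _)).ne_zero
  have hc (i) : conj g x i = ((g⁻¹ : GL (Fin n) k) : Matrix (Fin n) (Fin n) k)⁻¹ * x i *
      ((g⁻¹ : GL (Fin n) k) : Matrix (Fin n) (Fin n) k) := by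
    rw [← Matrix.coe_units_inv, inv_inv]; rfl
  refine ⟨fun i => ?_, fun i j => ?_⟩
  · rw [hc]; exact isNilpotent_inv_mul_mul hd (hx.1 i)
  · rw [hc, hc]; exact commute_inv_mul_mul hd (hx.2 i j)

/-- The group `GL` is irreducible, and those `g` that carry `x` into `cyclicLocus` form a nonempty
open, hence dense, subset. The identity lies in its closure, so `x` lies in the closure of
`cyclicLocus`. -/
theorem mem_closure_cyclicLocus [Infinite k] {x : MatTuple (m + 1) (q + 1) k}
    (hx : x ∈ commutingVariety (q + 1) (nilpotentCone (m + 1) k))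
    (hreg : IsRegularNilpotent (x 0)) : x ∈ closure (cyclicLocus m q k) := by
  let M : (Fin (m + 1) × Fin (m + 1) → k) → Matrix (Fin (m + 1)) (Fin (m + 1)) k :=
    fun g => Matrix.of fun i j => g (i, j)
  have hM : IsRegMat (fun g : Fin (m + 1) × Fin (m + 1) → k => g) M := fun i j =>
    coord_mem_regFun (fun g : Fin (m + 1) × Fin (m + 1) → k => g) (i, j)
  let U : Set (Fin (m + 1) × Fin (m + 1) → k) := {g | (M g).det ≠ 0}
  have hU : IsOpen U := isOpen_det_ne_zero isInducing_id_affine hM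
  let e (g : GL (Fin (m + 1)) k) : U := ⟨fun s => g.1 s.1 s.2,
    ((Matrix.isUnit_iff_isUnit_det _).1 (Units.isUnit g)).ne_zero⟩
  have : IrreducibleSpace U := isOpen_irreducibleSpace hU ⟨_, (e 1).2⟩
  let ψ (g : U) : MatTuple (m + 1) (q + 1) k := fun i => M g.1 * x i * (M g.1)⁻¹
  have hψe (g : GL (Fin (m + 1)) k) : ψ (e g) = conj g x := by
    funext i
    simp only [conj, Matrix.coe_units_inv]
    rfl
  have hψg (g : U) : ∃ g', e g' = g :=
    ⟨Matrix.GeneralLinearGroup.mkOfDetNeZero (M g.1) g.2, rfl⟩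
  have hψreg (i) : IsRegMat (fun g : U => g.1) fun g => ψ g i :=
    ((isRegMat_comp hM _).mul (IsRegMat.const _)).mul ((isRegMat_comp hM _).inv fun g => g.2)
  have hUi : IsInducing fun g : U => g.1 := IsInducing.subtypeVal
  have hψ : Continuous ψ :=
    continuous_of_mem_regFun hUi isInducing_coords (coords_mem_regFun hψreg)
  have hD : IsOpen {g : U | (krylov (ψ g 0)).det ≠ 0} :=
    isOpen_det_ne_zero hUi (hψreg 0).krylov
  obtain ⟨g, hg⟩ := hreg
  have hne : {g : U | (krylov (ψ g 0)).det ≠ 0}.Nonempty := by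
    -- This conjugation makes the first matrix the Jordan block itself, whose Krylov matrix is the
    -- identity.
    refine ⟨e g⁻¹, ?_⟩
    rw [Set.mem_ofPred_eq, hψe, conj, hg, inv_inv]
    simp only [Matrix.mul_assoc, Units.inv_mul, Matrix.mul_one, Units.inv_mul_cancel_left]
    rw [krylov_xReg]; simp
  have hdense := hD.dense hne
  have h1 : ψ (e 1) = x := by
    rw [hψe]; funext i; simp [conj]
  rw [← h1]
  refine closure_mono ?_ (image_closure_subset_closure_image hψ ⟨e 1, hdense _, rfl⟩)
  rintro _ ⟨g, hg, rfl⟩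
  obtain ⟨g', rfl⟩ := hψg g
  refine ⟨?_, hg⟩
  rw [hψe]
  exact conj_mem_commutingVariety g' hx

theorem regularClosure_eq [Infinite k] :
    regularClosure (m + 1) (q + 1) k = closure (cyclicLocus m q k) := by
  refine subset_antisymm (closure_minimal ?_ isClosed_closure) (closure_mono ?_)
  · rintro x ⟨hx, i, hi, hreg⟩
    obtain rfl : i = 0 := Fin.ext hi
    exact mem_closure_cyclicLocus hx hreg
  · intro x hx
    exact ⟨hx.1, 0, rfl, isRegularNilpotent_of_mem_cyclicLocus hx⟩

theorem continuous_cyclicTuple : Continuous fun t : cyclicDomain m q k => cyclicTuple t.1 :=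
  continuous_of_mem_regFun (ι := fun t : cyclicDomain m q k => t.1) IsInducing.subtypeVal
    isInducing_coords (coords_mem_regFun isRegMat_cyclicTuple)

theorem topologicalKrullDim_regularClosure [Infinite k] :
    topologicalKrullDim (regularClosure (m + 1) (q + 1) k) =
      ((m * (m + 1) + q * m : ℕ) : WithBot ℕ∞) := by
  have hcard : Fintype.card (CyclicParam m q) = m * (m + 1) + q * m := by simp
  have hirr := isOpen_irreducibleSpace (isOpen_cyclicDomain (m := m) (q := q) (k := k))
    cyclicDomain_nonempty
  rw [regularClosure_eq, ← range_cyclicTuple, ← hcard]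
  apply le_antisymm
  · exact topologicalKrullDim_le_card_of_subset_closure_range
      (ι := fun t : cyclicDomain m q k => t.1) IsInducing.subtypeVal isInducing_coords
      (coords_mem_regFun isRegMat_cyclicTuple) subset_rfl
  · refine card_le_topologicalKrullDim_of_leftInverse isOpen_cyclicDomain cyclicDomain_nonempty
      isInducing_coords continuous_cyclicTuple (v := cyclicCoord) (fun s => ?_)
      (fun t s => cyclicCoord_cyclicTuple t.2 s) subset_closure
    refine cyclicCoord_mem_regFun ?_ s
    rintro ⟨_, t, rfl⟩
    exact (cyclicTuple_mem_cyclicLocus t.2).2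

theorem exists_irreducibleComponent_le_regularClosure [Infinite k] :
    ∃ Z ∈ irreducibleComponents
        (commutingVariety (q + 1) (nilpotentCone (m + 1) k) : Set (MatTuple (m + 1) (q + 1) k)),
      topologicalKrullDim Z ≤ topologicalKrullDim (regularClosure (m + 1) (q + 1) k) := by
  have hirr := isOpen_irreducibleSpace (isOpen_cyclicDomain (m := m) (q := q) (k := k))
    cyclicDomain_nonempty
  rw [regularClosure_eq]
  refine exists_irreducibleComponent_le_closure (fun x hx => hx.1) ?_ ?_
  · rw [← range_cyclicTuple, ← Set.image_univ]
    exact (IrreducibleSpace.isIrreducible_univ _).image _ continuous_cyclicTuple.continuousOn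
  · let C : Set (MatTuple (m + 1) (q + 1) k) :=
      commutingVariety (q + 1) (nilpotentCone (m + 1) k)
    have hreg : IsRegMat (fun x : C => x.1.coords) fun x => krylov (x.1 0) :=
      (isRegMat_coords (fun x : C => x.1) 0).krylov
    have h : (Subtype.val ⁻¹' cyclicLocus m q k : Set C) = {x | (krylov (x.1 0)).det ≠ 0} := by
      ext x
      exact ⟨fun hx => hx.2, fun hx => ⟨x.2, hx⟩⟩
    exact h ▸ isOpen_det_ne_zero (isInducing_restrict isInducing_coords C) hreg

end RegularPart

/-! ### The big cell of `VP` and the comparison of dimensions. -/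

section BlockPart

variable {k : Type*} [Field k] {n r : ℕ}

/-- The indices of `Fin n`, split into the first `⌈n / 2⌉` and the last `⌊n / 2⌋` ones. -/
def halves (n : ℕ) : Fin ((n + 1) / 2) ⊕ Fin (n / 2) ≃ Fin n :=
  finSumFinEquiv.trans (finCongr (by omega))

theorem halves_inl (i : Fin ((n + 1) / 2)) : (halves n (Sum.inl i) : ℕ) = i := by
  simp [halves]

theorem halves_inr (i : Fin (n / 2)) : (halves n (Sum.inr i) : ℕ) = (n + 1) / 2 + i := by
  simp [halves]

/-- The parameters of the big cell of `VP`. -/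
abbrev CellParam (n r : ℕ) : Type :=
  (Fin ((n + 1) / 2) × Fin (n / 2)) ⊕ (Fin r × Fin (n / 2) × Fin ((n + 1) / 2))

/-- The off-diagonal block of a unipotent matrix. -/
def upperBlock (t : CellParam n r → k) : Matrix (Fin ((n + 1) / 2)) (Fin (n / 2)) k :=
  Matrix.of fun i j => t (Sum.inl (i, j))

/-- The blocks of a tuple in `nilradical`. -/
def lowerBlock (t : CellParam n r → k) (l : Fin r) : Matrix (Fin (n / 2)) (Fin ((n + 1) / 2)) k :=
  Matrix.of fun i j => t (Sum.inr (l, i, j))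

/-- The inclusion of the first `⌊n / 2⌋` indices into the first `⌈n / 2⌉` ones. -/
def halfIncl (n : ℕ) : Fin (n / 2) → Fin ((n + 1) / 2) := Fin.castLE (by omega)

/-- The parameters for which the first lower block has its first `⌊n / 2⌋` columns independent. -/
def cellDomain (n r : ℕ) (k : Type*) [Field k] [NeZero r] : Set (CellParam n r → k) :=
  {t | ((lowerBlock t 0).submatrix id (halfIncl n)).det ≠ 0}

/-- The parametrization of the big cell of `VP`. -/
def cellTuple (t : CellParam n r → k) : MatTuple n r k := fun l =>
  (Matrix.fromBlocks (upperBlock t * lowerBlock t l)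
    (-(upperBlock t * lowerBlock t l * upperBlock t)) (lowerBlock t l)
    (-(lowerBlock t l * upperBlock t))).submatrix (halves n).symm (halves n).symm

/-- The square part of the lower left block of the first matrix. -/
def pivot [NeZero r] (x : MatTuple n r k) : Matrix (Fin (n / 2)) (Fin (n / 2)) k :=
  (x 0).submatrix (fun i => halves n (Sum.inr i)) fun i => halves n (Sum.inl (halfIncl n i))

/-- The coordinates of the inverse of `cellTuple`. -/
noncomputable def cellCoord [NeZero r] (s : CellParam n r) (x : MatTuple n r k) : k :=
  Sum.elim (fun s => ((x 0).submatrix (fun i => halves n (Sum.inl i))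
      (fun i => halves n (Sum.inl (halfIncl n i))) * (pivot x)⁻¹) s.1 s.2)
    (fun s => x s.1 (halves n (Sum.inr s.2.1)) (halves n (Sum.inl s.2.2))) s

theorem isRegMat_upperBlock :
    IsRegMat (fun t : CellParam n r → k => t) fun t => upperBlock t :=
  fun i j => coord_mem_regFun (fun t : CellParam n r → k => t) (Sum.inl (i, j))

theorem isRegMat_lowerBlock (l : Fin r) :
    IsRegMat (fun t : CellParam n r → k => t) fun t => lowerBlock t l :=
  fun i j => coord_mem_regFun (fun t : CellParam n r → k => t) (Sum.inr (l, i, j))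

theorem isRegMat_cellTuple (l : Fin r) :
    IsRegMat (fun t : CellParam n r → k => t) fun t => cellTuple t l :=
  have hB := isRegMat_upperBlock (n := n) (r := r) (k := k)
  have hA := isRegMat_lowerBlock (n := n) (k := k) l
  (IsRegMat.fromBlocks (hB.mul hA) ((hB.mul hA).mul hB).neg hA (hA.mul hB).neg).submatrix _ _

theorem isOpen_cellDomain [NeZero r] : IsOpen (cellDomain n r k) :=
  isOpen_det_ne_zero isInducing_id_affine ((isRegMat_lowerBlock 0).submatrix _ _)

theorem cellDomain_nonempty [NeZero r] : (cellDomain n r k).Nonempty := by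
  refine ⟨Sum.elim 0 fun s => if halfIncl n s.2.1 = s.2.2 then 1 else 0, ?_⟩
  have : (lowerBlock (Sum.elim (0 : Fin ((n + 1) / 2) × Fin (n / 2) → k)
      fun s : Fin r × Fin (n / 2) × Fin ((n + 1) / 2) =>
        if halfIncl n s.2.1 = s.2.2 then (1 : k) else 0) 0).submatrix id (halfIncl n) = 1 := by
    ext i j
    simp [lowerBlock, halfIncl, Matrix.one_apply]
  simp only [cellDomain, Set.mem_ofPred_eq, this]
  simp

theorem pivot_cellTuple [NeZero r] (t : CellParam n r → k) :
    pivot (cellTuple t) = (lowerBlock t 0).submatrix id (halfIncl n) := by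
  ext i j
  simp [pivot, cellTuple]

/-- The lower left blocks are the parameters `A` themselves. The upper left block of the first
matrix is `B * A`, and its first `⌊n / 2⌋` columns determine `B` after division by the invertible
square part of `A`. -/
theorem cellCoord_cellTuple [NeZero r] {t : CellParam n r → k} (ht : t ∈ cellDomain n r k)
    (s : CellParam n r) : cellCoord s (cellTuple t) = t s := by
  rcases s with s | s
  · have h1 : (cellTuple t 0).submatrix (fun i => halves n (Sum.inl i))
        (fun i => halves n (Sum.inl (halfIncl n i))) =
        upperBlock t * (lowerBlock t 0).submatrix id (halfIncl n) := by
      ext i j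
      simp [cellTuple, Matrix.mul_apply]
    simp only [cellCoord, Sum.elim_inl, pivot_cellTuple, h1]
    rw [Matrix.mul_nonsing_inv_cancel_right _ _ (isUnit_iff_ne_zero.2 ht)]
    rfl
  · simp [cellCoord, cellTuple, lowerBlock]

theorem cellCoord_mem_regFun [NeZero r] {X : Type*} {F : X → MatTuple n r k}
    (hF : ∀ x, (pivot (F x)).det ≠ 0) (s : CellParam n r) :
    (fun x => cellCoord s (F x)) ∈ regFun fun x => (F x).coords := by
  have h (i) := isRegMat_coords F i
  rcases s with s | s
  · exact (((h 0).submatrix _ _).mul (((h 0).submatrix _ _).inv hF)) _ _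
  · exact h s.1 _ _

/-- The conjugating element is the block unipotent matrix with upper right block `B`; its inverse
has `-B` there. -/
theorem cellTuple_mem_VP (t : CellParam n r → k) : cellTuple t ∈ VP n r k := by
  let E := (Matrix.reindexAlgEquiv k k (halves n))
  let B := upperBlock t
  let g : GL (Fin n) k := ⟨E (Matrix.fromBlocks 1 B 0 1), E (Matrix.fromBlocks 1 (-B) 0 1),
    by rw [← map_mul, Matrix.fromBlocks_multiply]; simp,
    by rw [← map_mul, Matrix.fromBlocks_multiply]; simp⟩
  refine ⟨g, fun l => E (Matrix.fromBlocks 0 0 (lowerBlock t l) 0), fun l i j hij => ?_, ?_⟩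
  · obtain ⟨i, rfl⟩ := (halves n).surjective i
    obtain ⟨j, rfl⟩ := (halves n).surjective j
    rcases i with i | i <;> rcases j with j | j
    · simp [E]
    · simp [E]
    · exact absurd ⟨by rw [halves_inr]; omega, by rw [halves_inl]; exact j.2⟩ hij
    · simp [E]
  · funext l
    change _ = E _ * E _ * E _
    rw [← map_mul, ← map_mul, Matrix.fromBlocks_multiply, Matrix.fromBlocks_multiply]
    simp [cellTuple, E, B, Matrix.mul_assoc]

theorem VP_subset_commutingVariety : VP n r k ⊆ commutingVariety r (nilpotentCone n k) := by
  rintro _ ⟨g, x, hx, rfl⟩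
  -- Elements of the nilradical map into the last half of the coordinates and vanish on it, so any
  -- two have product zero. This gives nilpotency and commutation together.
  have hmul (i j) : x i * x j = 0 := by
    ext a b
    rw [Matrix.mul_apply]
    refine Finset.sum_eq_zero fun c _ => ?_
    by_cases hc : (c : ℕ) < (n + 1) / 2
    · rw [hx j c b (by omega), mul_zero]
    · rw [hx i a c (by omega), zero_mul]
  refine conj_mem_commutingVariety g ⟨fun i => ⟨2, by rw [pow_two, hmul]⟩, fun i j => ?_⟩
  rw [Commute, SemiconjBy, hmul, hmul]

theorem continuous_cellTuple [NeZero r] : Continuous fun t : cellDomain n r k => cellTuple t.1 :=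
  continuous_of_mem_regFun (ι := fun t : cellDomain n r k => t.1) IsInducing.subtypeVal
    isInducing_coords (coords_mem_regFun fun l => isRegMat_comp (isRegMat_cellTuple l) _)

theorem card_cellParam : Fintype.card (CellParam n r) = (r + 1) * ((n + 1) / 2 * (n / 2)) := by
  simp; ring

theorem le_topologicalKrullDim_VP [NeZero r] [Infinite k] :
    (((r + 1) * ((n + 1) / 2 * (n / 2)) : ℕ) : WithBot ℕ∞) ≤ topologicalKrullDim (VP n r k) := by
  rw [← card_cellParam]
  refine card_le_topologicalKrullDim_of_leftInverse isOpen_cellDomain cellDomain_nonempty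
    isInducing_coords continuous_cellTuple (v := cellCoord) (fun s => ?_)
    (fun t s => cellCoord_cellTuple t.2 s) ?_
  · refine cellCoord_mem_regFun ?_ s
    rintro ⟨_, t, rfl⟩
    rw [pivot_cellTuple]
    exact t.2
  · rintro _ ⟨t, rfl⟩
    exact cellTuple_mem_VP _

theorem exists_irreducibleComponent_le_topologicalKrullDim [NeZero r] [Infinite k] :
    ∃ W ∈ irreducibleComponents
        (commutingVariety r (nilpotentCone n k) : Set (MatTuple n r k)),
      (((r + 1) * ((n + 1) / 2 * (n / 2)) : ℕ) : WithBot ℕ∞) ≤ topologicalKrullDim W := by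
  have hirr := isOpen_irreducibleSpace (isOpen_cellDomain (n := n) (r := r) (k := k))
    cellDomain_nonempty
  let f (t : cellDomain n r k) :
      (commutingVariety r (nilpotentCone n k) : Set (MatTuple n r k)) :=
    ⟨cellTuple t.1, VP_subset_commutingVariety (cellTuple_mem_VP t.1)⟩
  have hf : Continuous f := continuous_cellTuple.subtype_mk _
  have hO : IsIrreducible (Set.range f) := by
    rw [← Set.image_univ]
    exact (IrreducibleSpace.isIrreducible_univ _).image f hf.continuousOn
  obtain ⟨W, hW, hOW⟩ := exists_mem_irreducibleComponents_subset_of_isIrreducible _ hO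
  refine ⟨W, hW, ?_⟩
  rw [← card_cellParam]
  refine card_le_topologicalKrullDim_of_leftInverse isOpen_cellDomain cellDomain_nonempty
    (isInducing_restrict isInducing_coords _) hf (v := fun s x => cellCoord s x.1) (fun s => ?_)
    (fun t s => cellCoord_cellTuple t.2 s) hOW
  refine cellCoord_mem_regFun (F := fun y : Set.range f => y.1.1) ?_ s
  rintro ⟨_, t, rfl⟩
  change (pivot (cellTuple t.1)).det ≠ 0
  rw [pivot_cellTuple]
  exact t.2

/-- The right side minus the left is `a(q(a-1) - 2a)` for `m = 2a` and `a(qa - 2a - 2)` for `m = 2a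
+ 1`. Writing `a` and `q` as their least admissible values plus `b` and `c`, the second factor
becomes `cb + c + 3b + 1` when `q ≥ 5`, and `cb + 3c + b + 1` in the other range. -/
theorem card_cyclicParam_lt_card_cellParam {m q : ℕ}
    (h : (3 < m + 1 ∧ 6 ≤ q + 1) ∨ (7 < m + 1 ∧ 3 < q + 1)) :
    m * (m + 1) + q * m < (q + 1 + 1) * ((m + 1 + 1) / 2 * ((m + 1) / 2)) := by
  rcases Nat.even_or_odd' m with ⟨a, rfl | rfl⟩
  · rw [show (2 * a + 1 + 1) / 2 = a + 1 by omega, show (2 * a + 1) / 2 = a by omega]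
    rcases h with h | h
    · obtain ⟨b, rfl⟩ : ∃ b, a = b + 2 := ⟨a - 2, by omega⟩
      obtain ⟨c, rfl⟩ : ∃ c, q = c + 5 := ⟨q - 5, by omega⟩
      nlinarith [Nat.zero_le (c * b), Nat.zero_le (c * b * b), Nat.zero_le (b * b)]
    · obtain ⟨b, rfl⟩ : ∃ b, a = b + 4 := ⟨a - 4, by omega⟩
      obtain ⟨c, rfl⟩ : ∃ c, q = c + 3 := ⟨q - 3, by omega⟩
      nlinarith [Nat.zero_le (c * b), Nat.zero_le (c * b * b), Nat.zero_le (b * b)]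
  · rw [show (2 * a + 1 + 1 + 1) / 2 = a + 1 by omega, show (2 * a + 1 + 1) / 2 = a + 1 by omega]
    rcases h with h | h
    · obtain ⟨b, rfl⟩ : ∃ b, a = b + 1 := ⟨a - 1, by omega⟩
      obtain ⟨c, rfl⟩ : ∃ c, q = c + 5 := ⟨q - 5, by omega⟩
      nlinarith [Nat.zero_le (c * b), Nat.zero_le (c * b * b), Nat.zero_le (b * b)]
    · obtain ⟨b, rfl⟩ : ∃ b, a = b + 3 := ⟨a - 3, by omega⟩
      obtain ⟨c, rfl⟩ : ∃ c, q = c + 3 := ⟨q - 3, by omega⟩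
      nlinarith [Nat.zero_le (c * b), Nat.zero_le (c * b * b), Nat.zero_le (b * b)]

end BlockPart

end NilpotentCommuting

theorem mainTheorem6 (k : Type*) [Field k] [IsAlgClosed k] (n r : ℕ)
    (h : (3 < n ∧ 6 ≤ r) ∨ (7 < n ∧ 3 < r)) :
    topologicalKrullDim (NilpotentCommuting.regularClosure n r k) =
        ((n ^ 2 - n + (r - 1) * (n - 1) : ℕ) : WithBot ℕ∞) ∧
      topologicalKrullDim (NilpotentCommuting.regularClosure n r k) <
        topologicalKrullDim (NilpotentCommuting.VP n r k) ∧
      ¬ NilpotentCommuting.IsEquidimensional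
        (NilpotentCommuting.commutingVariety r (NilpotentCommuting.nilpotentCone n k)) := by
  have : Infinite k := IsAlgClosed.instInfinite
  obtain ⟨m, rfl⟩ : ∃ m, n = m + 1 := ⟨n - 1, by omega⟩
  obtain ⟨q, rfl⟩ : ∃ q, r = q + 1 := ⟨r - 1, by omega⟩
  have hdim := NilpotentCommuting.topologicalKrullDim_regularClosure (k := k) (m := m) (q := q)
  have hlt : ((m * (m + 1) + q * m : ℕ) : WithBot ℕ∞) <
      (((q + 1 + 1) * ((m + 1 + 1) / 2 * ((m + 1) / 2)) : ℕ) : WithBot ℕ∞) := by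
    exact_mod_cast NilpotentCommuting.card_cyclicParam_lt_card_cellParam h
  refine ⟨?_, ?_, fun heq => ?_⟩
  · rw [hdim]
    congr 2
    have : (m + 1) ^ 2 - (m + 1) = m * (m + 1) := by
      rw [Nat.sub_eq_iff_eq_add (by nlinarith)]; ring
    rw [this]
  · rw [hdim]
    exact hlt.trans_le NilpotentCommuting.le_topologicalKrullDim_VP
  -- An upper bound for one component and a lower bound for another suffice; neither component need
  -- be identified.
  · obtain ⟨Z, hZ, hZd⟩ :=
      NilpotentCommuting.exists_irreducibleComponent_le_regularClosure (k := k)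
        (m := m) (q := q)
    obtain ⟨W, hW, hWd⟩ := NilpotentCommuting.exists_irreducibleComponent_le_topologicalKrullDim
      (k := k) (n := m + 1) (r := q + 1)
    rw [hdim] at hZd
    exact absurd (heq Z hZ W hW) ((hZd.trans_lt hlt).trans_le hWd).ne
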